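/- **Model.** Let $K\ge 1$, let $\Xi\subset[0,\infty)$ be a finite nonempty set of rewards with maximum $r_{\max}$, and for $i\in\{1,\dots,K\}$ let $\lambda_i\ge 0$ be an arrival rate and $\ell_i:\Xi\to(0,1]$ a non-increasing departure probability function. Let $R:[0,\infty)\to[0,\infty)$ be non-decreasing, concave, and differentiable on $(0,\infty)$. For a distribution $\mathbf x=(x_r)_{r\in\Xi}$ on $\Xi$ and a scale $\theta\in\{1,2,\dots\}$, the static policy $\mathbf x$ induces the following Markov chain $\mathbf N^\theta(t)=(N_i^\theta(t))_{i\le K}$ on $\mathbb N^K$, started at a given $\mathbf N^\theta(0)=\mathbf c_0\in\mathbb N^K$: in period $t$ each worker on the platform independently draws a reward $r$ from $\mathbf x$ and, if she is of type $i$, then leaves with probability $\ell_i(r)$; if $D_i(t)$ workers of type $i$ leave, then $N_i^\theta(t+1)=N_i^\theta(t)-D_i(t)+A_i(t+1)$, where the arrivals $A_i(t+1)\sim\mathrm{Pois}(\theta\lambda_i)$ are independent across types and periods and independent of all else. With $N^\theta(t)=\sum_i N^\theta_i(t)$, the normalized profit of period $t$ is $$\widehat\Pi^\theta(t)=R\!\left(\frac{N^\theta(t)}{\theta}\right)-\frac{N^\theta(t)}{\theta}\sum_{r}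 r x_r ,$$ and the long-run average normalized profit is $$v_\theta(\mathbf x)=\lim_{T\to\infty}\frac1T\sum_{t=1}^T\mathbb E\big[\widehat\Pi^\theta(t)\,\big|\,\mathbf N^\theta(0)=\mathbf c_0\big].$$ The fluid problem is $$\widetilde\Pi^*=\max\Big\{R\Big(\sum_i\widetilde N_i\Big)-\Big(\sum_r r x_r\Big)\sum_i\widetilde N_i\Big\}$$ over all distributions $\mathbf x$ on $\Xi$ and all real vectors $\widetilde{\mathbf N}\in[0,\infty)^K$ with $\lambda_i=\widetilde N_i\sum_r\ell_i(r)x_r$ for every $i$. Put $\overline\Lambda=\sum_i\lambda_i/\ell_i(r_{\max})$. **Theorem.** The maximum in the fluid problem is attained, and the following hold. 1. If $R$ is Lipschitz continuous on $(0,\infty)$, then there is a constant $C_L>0$ such that for every optimal reward distribution $\mathbf x^\star$ of the fluid problem, every $\theta\in\{1,2,\dots\}$ and every initial state $\mathbf c_0$, the expected profits are finite, the limit $v_\theta(\mathbf x^\star)$ exists, and $$v_\theta(\mathbf x^\star)\ \ge\ \widetilde\Pi^*-\frac{C_L}{\sqrt\theta}.$$ 2. If $R$ is twice continuously differentiable on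 $(0,\infty)$, then for every $\alpha>0$ there is a constant $C>0$ such that for every optimal reward distribution $\mathbf x^\star$, every $\theta\in\{1,2,\dots\}$ for which $R''(y)\ge-\theta^{\alpha}$ for all $y\in[1/\theta,\overline\Lambda)$, and every initial state $\mathbf c_0$, the expected profits are finite, the limit $v_\theta(\mathbf x^\star)$ exists, and $$v_\theta(\mathbf x^\star)\ \ge\ \widetilde\Pi^*-\frac{C}{\theta}.$$ The constants depend only on the primitives $K,\Xi,\lambda,\ell,R$ (and $C$ also on $\alpha$), not on $\theta$, $\mathbf c_0$ or the choice of $\mathbf x^\star$. -/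

import Mathlib

open MeasureTheory ProbabilityTheory Set Filter Topology
open scoped NNReal ENNReal

noncomputable section

/-- The primitives of a labor platform: a finite nonempty set `Ξ` of nonnegative rewards, `K ≥ 1`
worker types with Poisson arrival rates `lam i` and non-increasing departure probability functions
`ℓ i : Ξ → (0, 1]`, and a revenue function `R : ℝ₊ → ℝ₊` (only its values on `[0, ∞)` matter) that
is non-decreasing and concave, and differentiable on `(0, ∞)`. -/
structure Platform where
  K : ℕ
  K_pos : 1 ≤ K
  Ξ : Finset ℝ
  Ξ_nonempty : Ξ.Nonempty
  Ξ_nonneg : ∀ r ∈ Ξ, 0 ≤ r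
  lam : Fin K → ℝ≥0
  ℓ : Fin K → Ξ → ℝ
  ℓ_pos : ∀ i r, 0 < ℓ i r
  ℓ_le_one : ∀ i r, ℓ i r ≤ 1
  ℓ_antitone : ∀ i, Antitone (ℓ i)
  R : ℝ → ℝ
  R_nonneg : ∀ y, 0 ≤ y → 0 ≤ R y
  R_differentiable : DifferentiableOn ℝ R (Ioi 0)
  R_monotone : MonotoneOn R (Ici 0)
  R_concave : ConcaveOn ℝ (Ici 0) R

namespace Platform

variable (P : Platform)

/-- The largest reward in `Ξ`. -/
def rMax : P.Ξ := ⟨P.Ξ.max' P.Ξ_nonempty, P.Ξ.max'_mem P.Ξ_nonempty⟩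

/-- `Λ̄ = ∑ i, λ i / ℓ i r_max`. -/
def LamBar : ℝ := ∑ i, (P.lam i : ℝ) / P.ℓ i P.rMax

/-- The mean reward `∑ r, r * x r`. -/
def meanReward (x : P.Ξ → ℝ) : ℝ := ∑ r : P.Ξ, (r : ℝ) * x r

/-! ### The fluid relaxation -/

/-- Feasibility for the fluid problem: `x` is a distribution over rewards, `n i ≥ 0` is the fluid
mass of type `i` workers, and arrivals balance departures for each type. -/
def FluidFeasible (x : P.Ξ → ℝ) (n : Fin P.K → ℝ) : Prop :=
  x ∈ stdSimplex ℝ P.Ξ ∧ (∀ i, 0 ≤ n i) ∧ ∀ i, (P.lam i : ℝ) = n i * ∑ r, P.ℓ i r * x r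

/-- The fluid objective. -/
def fluidObjective (x : P.Ξ → ℝ) (n : Fin P.K → ℝ) : ℝ :=
  P.R (∑ i, n i) - P.meanReward x * ∑ i, n i

/-- The optimal value of the fluid problem. -/
def fluidValue : ℝ :=
  sSup {z | ∃ x n, P.FluidFeasible x n ∧ z = P.fluidObjective x n}

/-- `x` is the reward distribution of an optimal solution of the fluid problem. -/
def IsFluidOptimal (x : P.Ξ → ℝ) : Prop :=
  ∃ n, P.FluidFeasible x n ∧
    ∀ y m, P.FluidFeasible y m → P.fluidObjective y m ≤ P.fluidObjective x n

/-! ### The stochastic system under the static policy `x` at scale `θ` -/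

/-- The law on `Ξ` of a reward drawn from the distribution `x`. -/
def rewardLaw (x : P.Ξ → ℝ) : Measure P.Ξ :=
  ∑ r, ENNReal.ofReal (x r) • Measure.dirac r

/-- The probability that a type `i` worker leaves after receiving `r`, as a point of `[0, 1]`. -/
def leaveProb (i : Fin P.K) (r : P.Ξ) : unitInterval :=
  ⟨P.ℓ i r, (P.ℓ_pos i r).le, P.ℓ_le_one i r⟩

/-- The joint law of the reward of one type `i` worker in one period and of her decision (`true`
means that she leaves): the reward `r` is drawn from `x`, then she leaves with probability
`ℓ i r`. -/
def workerLaw (x : P.Ξ → ℝ) (i : Fin P.K) : Measure (P.Ξ × Bool) :=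
  (P.rewardLaw x).bind fun r => bernoulliMeasure (r, true) (r, false) (P.leaveProb i r)

/-- The number of departures, given the rewards and decisions of `m` workers. -/
def departures {m : ℕ} (ω : Fin m → P.Ξ × Bool) : ℕ :=
  (Finset.univ.filter fun w => (ω w).2 = true).card

/-- The law of the next number `m - D + A` of type `i` workers, given that `m` of them are on the
platform now: they act independently, `D` of them leave, and an independent `Poisson (θ * lam i)`
number `A` of new ones arrives. (Here `D ≤ m`, so that the subtraction is the true one.) -/
def typeStep (θ : ℕ) (x : P.Ξ → ℝ) (i : Fin P.K) (m : ℕ) : Measure ℕ :=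
  ((Measure.pi fun _ : Fin m => P.workerLaw x i).prod (poissonMeasure (θ * P.lam i))).map
    fun p => m - P.departures p.1 + p.2

/-- The transition law of the Markov chain `N(t) = (N_i(t))_i` from the state `n`; the types evolve
independently of each other. -/
def step (θ : ℕ) (x : P.Ξ → ℝ) (n : Fin P.K → ℕ) : Measure (Fin P.K → ℕ) :=
  Measure.pi fun i => P.typeStep θ x i (n i)

/-- The law of the state `N(t)` given `N(0) = c₀`. -/
def stateLaw (θ : ℕ) (x : P.Ξ → ℝ) (c₀ : Fin P.K → ℕ) : ℕ → Measure (Fin P.K → ℕ)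
  | 0 => Measure.dirac c₀
  | t + 1 => (stateLaw θ x c₀ t).bind (P.step θ x)

/-- The normalized profit of a period that starts in state `n` (in expectation over the rewards):
`R (N / θ) - (N / θ) * ∑ r, r * x r` with `N = ∑ i, n i`. -/
def profit (θ : ℕ) (x : P.Ξ → ℝ) (n : Fin P.K → ℕ) : ℝ :=
  P.R ((∑ i, n i : ℕ) / (θ : ℝ)) - (∑ i, n i : ℕ) / (θ : ℝ) * P.meanReward x

/-- `v` is the long-run average normalized profit of the static policy `x` at scale `θ` from the
initial state `c₀`: all period profits are integrable, and
`(1 / T) * ∑_{t = 1}^T E[profit in period t]` tends to `v` as `T → ∞`. -/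
def IsLongRunAverage (θ : ℕ) (x : P.Ξ → ℝ) (c₀ : Fin P.K → ℕ) (v : ℝ) : Prop :=
  (∀ t, Integrable (P.profit θ x) (P.stateLaw θ x c₀ t)) ∧
    Tendsto
      (fun T : ℕ => 1 / (T : ℝ) *
        ∑ t ∈ Finset.Icc 1 T, ∫ n, P.profit θ x n ∂(P.stateLaw θ x c₀ t))
      atTop (𝓝 v)

end Platform

end

/-!
The numbers of workers of the different types evolve independently, and from `m` workers of type `i`
the next number is a binomial thinning of `m` with survival probability `1 - q_i`, plus a
`Poisson (θ λ_i)` variable, where `q_i = ∑ r, ℓ i r * x r` is positive. Everything about the chain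
follows from one identity, `Platform.typeStep_succ`: one more worker at the start of a period is
gone at its end with probability `q_i` and is one more worker at its end otherwise.

* By induction on `m` it gives the first two moments of a transition. Hence `N_i(t)` has mean and
  centred second moment converging geometrically to those of a Poisson variable with mean
  `a_i = θ n_i`, where `n_i = λ_i / q_i` is the fluid mass (`Platform.integral_stateLaw_sub`,
  `Platform.integral_stateLaw_sub_sq`).
* Through the product structure it shows that the transition operator contracts Lipschitz functions
  of the state by the factor `max_i (1 - q_i) < 1`, so that their expectations converge
  (`Platform.StepLipschitz.exists_tendsto`). As `R` is concave and non-decreasing, its increments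
  along `ℕ / θ` are bounded by the first one, so the profit is such a function and the long-run
  average exists.

Write `N = ∑ i, n i`. Whenever `R y ≥ R N + b (y - N) - C (y - N)² - e` for all `y ≥ 0`, taking
expectations and letting `t → ∞` kills the linear term and turns the quadratic one into at most
`C K N / θ` (`Platform.exists_longRunAverage`); the fluid masses of all feasible points lie between
`∑ i, λ i` and `Λ̄`. For Lipschitz `R` such a bound holds with `b = 0`, `C` of order `√θ` and `e` of
order `1 / √θ` (`Platform.lipschitz_lower_bound`). For twice continuously differentiable `R` it
holds with `b = R' N`, `e = 0` and `C` uniform in `N` (`Platform.exists_taylor_lower_bound`): a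
compactness bound on `R''` around `[∑ i, λ i, Λ̄]` controls the neighbourhood of `N`, and away from
it nonnegativity and monotonicity of `R` suffice.

An optimal fluid solution exists because the objective is a continuous function of `x` on the
simplex (`Platform.exists_isFluidOptimal`). The case `∑ i, λ i = 0`, in which `N = 0` and `R` may be
discontinuous at `N`, is treated apart; there `R y ≥ R 0` is all that is needed.
-/

noncomputable section

/-! ### Moments of the Poisson distribution -/

/-- The identity `E[N g(N)] = r E[g(N + 1)]` for `N ∼ Poisson r`, in summation form. -/
lemma hasSum_poisson_mul {r : ℝ≥0} {g : ℕ → ℝ} {S : ℝ}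
    (h : HasSum (fun n : ℕ ↦ Real.exp (-r) * r ^ n / n.factorial * g (n + 1)) S) :
    HasSum (fun n : ℕ ↦ Real.exp (-r) * r ^ n / n.factorial * (n * g n)) (r * S) := by
  rw [← hasSum_nat_add_iff' 1]
  simp only [Finset.range_one, Finset.sum_singleton, Nat.cast_zero, zero_mul, mul_zero, sub_zero]
  convert! h.mul_left (r : ℝ) using 1
  funext n
  rw [Nat.factorial_succ]
  push_cast
  field_simp
  ring

lemma hasSum_poisson_id (r : ℝ≥0) :
    HasSum (fun n : ℕ ↦ Real.exp (-r) * r ^ n / n.factorial * (n : ℝ)) r := by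
  have h := hasSum_poisson_mul (r := r) (g := fun _ ↦ 1) (S := 1)
    (by simpa using hasSum_one_poissonMeasure r)
  simpa using h

lemma hasSum_poisson_sq (r : ℝ≥0) :
    HasSum (fun n : ℕ ↦ Real.exp (-r) * r ^ n / n.factorial * (n : ℝ) ^ 2) (r * (r + 1)) := by
  have h := hasSum_poisson_mul (r := r) (g := fun n ↦ (n : ℝ)) (S := r + 1) (by
    simpa [mul_add] using (hasSum_poisson_id r).add (hasSum_one_poissonMeasure r))
  simpa [sq] using h

lemma integrable_sq_poissonMeasure (r : ℝ≥0) :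
    Integrable (fun n : ℕ ↦ (n : ℝ) ^ 2) (poissonMeasure r) := by
  rw [integrable_poissonMeasure_iff]
  simpa using (hasSum_poisson_sq r).summable

lemma integral_id_poissonMeasure (r : ℝ≥0) : ∫ n : ℕ, (n : ℝ) ∂poissonMeasure r = r := by
  rw [integral_poissonMeasure]
  exact (hasSum_poisson_id r).tsum_eq

lemma integral_sq_poissonMeasure (r : ℝ≥0) :
    ∫ n : ℕ, (n : ℝ) ^ 2 ∂poissonMeasure r = r * (r + 1) := by
  rw [integral_poissonMeasure]
  exact (hasSum_poisson_sq r).tsum_eq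

namespace Platform

variable (P : Platform) {x : P.Ξ → ℝ}

/-! ### One type of workers during one period -/

/-- The probability `q_i = ∑ r, ℓ i r * x r` that a type `i` worker leaves in a given period. -/
def leaveRate (x : P.Ξ → ℝ) (i : Fin P.K) : ℝ := ∑ r, P.ℓ i r * x r

variable {P}

lemma le_leaveRate (hx : x ∈ stdSimplex ℝ P.Ξ) (i : Fin P.K) :
    P.ℓ i P.rMax ≤ P.leaveRate x i := by
  calc P.ℓ i P.rMax = ∑ r, P.ℓ i P.rMax * x r := by rw [← Finset.mul_sum, hx.2, mul_one]
    _ ≤ _ := Finset.sum_le_sum fun r _ ↦ mul_le_mul_of_nonneg_right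
      (P.ℓ_antitone i (P.Ξ.le_max' r r.2)) (hx.1 r)

lemma leaveRate_pos (hx : x ∈ stdSimplex ℝ P.Ξ) (i : Fin P.K) : 0 < P.leaveRate x i :=
  (P.ℓ_pos i _).trans_le (le_leaveRate hx i)

lemma leaveRate_le_one (hx : x ∈ stdSimplex ℝ P.Ξ) (i : Fin P.K) : P.leaveRate x i ≤ 1 := by
  calc P.leaveRate x i ≤ ∑ r, x r := Finset.sum_le_sum fun r _ ↦
        mul_le_of_le_one_left (hx.1 r) (P.ℓ_le_one i r)
    _ = 1 := hx.2

/-- Integration against the law of one worker only sees whether she leaves. -/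
lemma lintegral_workerLaw (hx : x ∈ stdSimplex ℝ P.Ξ) (i : Fin P.K) (F : Bool → ℝ≥0∞) :
    ∫⁻ w, F w.2 ∂P.workerLaw x i =
      ENNReal.ofReal (P.leaveRate x i) * F true + ENNReal.ofReal (1 - P.leaveRate x i) * F false := by
  have h1 (r : P.Ξ) : ((unitInterval.toNNReal (P.leaveProb i r) : ℝ≥0) : ℝ≥0∞) =
      ENNReal.ofReal (P.ℓ i r) := by
    rw [ENNReal.ofReal]; congr 1; ext; simp [leaveProb, (P.ℓ_pos i r).le]
  have h2 (r : P.Ξ) : ((unitInterval.toNNReal (unitInterval.symm (P.leaveProb i r)) : ℝ≥0) : ℝ≥0∞)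
      = ENNReal.ofReal (1 - P.ℓ i r) := by
    rw [ENNReal.ofReal]; congr 1; ext; simp [leaveProb, P.ℓ_le_one i r]
  have hq : 1 - P.leaveRate x i = ∑ r, (1 - P.ℓ i r) * x r := by
    simp only [leaveRate, sub_mul, one_mul, Finset.sum_sub_distrib, hx.2]
  rw [workerLaw, Measure.lintegral_bind Measurable.of_discrete.aemeasurable
    Measurable.of_discrete.aemeasurable, rewardLaw, hq, leaveRate,
    ENNReal.ofReal_sum_of_nonneg fun r _ ↦ mul_nonneg (P.ℓ_pos i r).le (hx.1 r),
    ENNReal.ofReal_sum_of_nonneg fun r _ ↦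
      mul_nonneg (sub_nonneg.2 (P.ℓ_le_one i r)) (hx.1 r), Finset.sum_mul, Finset.sum_mul,
    ← Finset.sum_add_distrib, lintegral_finsetSum_measure]
  refine Finset.sum_congr rfl fun r _ ↦ ?_
  rw [lintegral_smul_measure, lintegral_dirac, bernoulliMeasure_def, lintegral_add_measure]
  simp only [ENNReal.smul_def, lintegral_smul_measure, lintegral_dirac,
    smul_eq_mul, h1, h2]
  rw [ENNReal.ofReal_mul (P.ℓ_pos i r).le, ENNReal.ofReal_mul (sub_nonneg.2 (P.ℓ_le_one i r))]
  ring

lemma isProbabilityMeasure_workerLaw (hx : x ∈ stdSimplex ℝ P.Ξ) (i : Fin P.K) :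
    IsProbabilityMeasure (P.workerLaw x i) := by
  constructor
  have h := lintegral_workerLaw hx i fun _ ↦ 1
  rw [← ENNReal.ofReal_one, lintegral_const] at h
  simp only [ENNReal.ofReal_one, one_mul, mul_one] at h
  rw [h, ← ENNReal.ofReal_add (leaveRate_pos hx i).le (by linarith [leaveRate_le_one hx i])]
  simp

lemma isProbabilityMeasure_typeStep (hx : x ∈ stdSimplex ℝ P.Ξ) (θ : ℕ) (i : Fin P.K) (m : ℕ) :
    IsProbabilityMeasure (P.typeStep θ x i m) := by
  have := isProbabilityMeasure_workerLaw hx i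
  exact Measure.isProbabilityMeasure_map Measurable.of_discrete.aemeasurable

lemma lintegral_typeStep (hx : x ∈ stdSimplex ℝ P.Ξ) (θ : ℕ) (i : Fin P.K) (m : ℕ)
    (f : ℕ → ℝ≥0∞) :
    ∫⁻ k, f k ∂P.typeStep θ x i m =
      ∫⁻ ω, ∫⁻ a, f (m - P.departures ω + a) ∂poissonMeasure (θ * P.lam i)
        ∂(Measure.pi fun _ : Fin m => P.workerLaw x i) := by
  have := isProbabilityMeasure_workerLaw hx i
  rw [typeStep, lintegral_map Measurable.of_discrete Measurable.of_discrete,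
    lintegral_prod _ Measurable.of_discrete.aemeasurable]

lemma departures_le {m : ℕ} (ω : Fin m → P.Ξ × Bool) : P.departures ω ≤ m :=
  (Finset.card_filter_le _ _).trans_eq (Finset.card_fin m)

lemma departures_cons {m : ℕ} (w : P.Ξ × Bool) (ω : Fin m → P.Ξ × Bool) :
    P.departures (Fin.cons w ω : Fin (m + 1) → P.Ξ × Bool) =
      (if w.2 = true then 1 else 0) + P.departures ω := by
  simp only [departures, Finset.card_filter, Fin.sum_univ_succ, Fin.cons_zero, Fin.cons_succ]

lemma typeStep_zero (hx : x ∈ stdSimplex ℝ P.Ξ) (θ : ℕ) (i : Fin P.K) :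
    P.typeStep θ x i 0 = poissonMeasure (θ * P.lam i) := by
  have := isProbabilityMeasure_workerLaw hx i
  refine Measure.ext_of_lintegral _ fun f _ ↦ ?_
  rw [lintegral_typeStep hx]
  simp

/-- One more worker at the start of the period leaves, or else is still there at its end. -/
lemma typeStep_succ (hx : x ∈ stdSimplex ℝ P.Ξ) (θ : ℕ) (i : Fin P.K) (m : ℕ) :
    P.typeStep θ x i (m + 1) = ENNReal.ofReal (P.leaveRate x i) • P.typeStep θ x i m +
      ENNReal.ofReal (1 - P.leaveRate x i) • (P.typeStep θ x i m).map (· + 1) := by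
  have := isProbabilityMeasure_workerLaw hx i
  refine Measure.ext_of_lintegral _ fun f _ ↦ ?_
  rw [lintegral_add_measure, lintegral_smul_measure, lintegral_smul_measure,
    lintegral_map Measurable.of_discrete Measurable.of_discrete, lintegral_typeStep hx,
    lintegral_typeStep hx, lintegral_typeStep hx,
    ← ((measurePreserving_piFinSuccAbove (fun _ : Fin (m + 1) ↦ P.workerLaw x i) 0).symm).lintegral_comp
      Measurable.of_discrete, lintegral_prod _ Measurable.of_discrete.aemeasurable]
  have key (w : P.Ξ × Bool) (ω : Fin m → P.Ξ × Bool) (a : ℕ) :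
      m + 1 - P.departures ((MeasurableEquiv.piFinSuccAbove
        (fun _ : Fin (m + 1) ↦ P.Ξ × Bool) 0).symm (w, ω)) + a =
      m - P.departures ω + a + bif w.2 then 0 else 1 := by
    have h : (MeasurableEquiv.piFinSuccAbove (fun _ : Fin (m + 1) ↦ P.Ξ × Bool) 0).symm (w, ω) =
      (Fin.cons w ω : Fin (m + 1) → P.Ξ × Bool) := by
      simp [MeasurableEquiv.piFinSuccAbove_symm_apply, Fin.insertNthEquiv]
    have := departures_le ω
    rw [h, departures_cons]
    rcases w with ⟨r, _ | _⟩ <;> simp <;> omega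
  simp only [key]
  exact lintegral_workerLaw hx i fun b ↦ ∫⁻ ω, ∫⁻ a, f (m - P.departures ω + a + bif b then 0 else 1)
    ∂poissonMeasure (θ * P.lam i) ∂(Measure.pi fun _ : Fin m => P.workerLaw x i)

lemma integrable_typeStep_succ (hx : x ∈ stdSimplex ℝ P.Ξ) {θ : ℕ} {i : Fin P.K} {m : ℕ}
    {g : ℕ → ℝ} (h0 : Integrable g (P.typeStep θ x i m))
    (h1 : Integrable (fun k ↦ g (k + 1)) (P.typeStep θ x i m)) :
    Integrable g (P.typeStep θ x i (m + 1)) ∧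
    ∫ k, g k ∂P.typeStep θ x i (m + 1) = P.leaveRate x i * ∫ k, g k ∂P.typeStep θ x i m +
      (1 - P.leaveRate x i) * ∫ k, g (k + 1) ∂P.typeStep θ x i m := by
  have h1' : Integrable g ((P.typeStep θ x i m).map (· + 1)) :=
    (integrable_map_measure Measurable.of_discrete.aestronglyMeasurable
      Measurable.of_discrete.aemeasurable).2 h1
  have h2 := h0.smul_measure (c := ENNReal.ofReal (P.leaveRate x i)) ENNReal.ofReal_ne_top
  have h3 := h1'.smul_measure (c := ENNReal.ofReal (1 - P.leaveRate x i)) ENNReal.ofReal_ne_top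
  rw [typeStep_succ hx]
  refine ⟨h2.add_measure h3, ?_⟩
  rw [integral_add_measure h2 h3, integral_smul_measure, integral_smul_measure,
    integral_map Measurable.of_discrete.aemeasurable Measurable.of_discrete.aestronglyMeasurable,
    ENNReal.toReal_ofReal (leaveRate_pos hx i).le,
    ENNReal.toReal_ofReal (sub_nonneg.2 (leaveRate_le_one hx i)), smul_eq_mul, smul_eq_mul]

lemma integrable_sq_typeStep (hx : x ∈ stdSimplex ℝ P.Ξ) (θ : ℕ) (i : Fin P.K) (m : ℕ) :
    Integrable (fun k : ℕ ↦ (k : ℝ) ^ 2) (P.typeStep θ x i m) := by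
  induction m with
  | zero => rw [typeStep_zero hx]; exact integrable_sq_poissonMeasure _
  | succ m ih =>
    have := isProbabilityMeasure_typeStep hx θ i m
    refine (integrable_typeStep_succ hx ih ?_).1
    refine ((ih.const_mul 2).add (integrable_const 2)).mono'
      Measurable.of_discrete.aestronglyMeasurable (ae_of_all _ fun k ↦ ?_)
    rw [Real.norm_eq_abs, abs_of_nonneg (by positivity)]
    simp only [Pi.add_apply]
    push_cast
    nlinarith [sq_nonneg ((k : ℝ) - 1)]

/-- A measure on a discrete space with finite second moment of `φ : α → ℕ` has a finite first
moment. -/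
lemma integrable_of_sq {α : Type*} [MeasurableSpace α] [DiscreteMeasurableSpace α] {μ : Measure α}
    {φ : α → ℕ} (h : Integrable (fun k ↦ (φ k : ℝ) ^ 2) μ) :
    Integrable (fun k ↦ (φ k : ℝ)) μ := by
  refine h.mono' Measurable.of_discrete.aestronglyMeasurable (ae_of_all _ fun k ↦ ?_)
  rw [Real.norm_eq_abs, Nat.abs_cast]
  exact_mod_cast Nat.le_self_pow two_ne_zero (φ k)

lemma integral_affine_combination {α : Type*} [MeasurableSpace α] {μ : Measure α}
    [IsProbabilityMeasure μ] {f g : α → ℝ} (hf : Integrable f μ) (hg : Integrable g μ)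
    (A B C : ℝ) : ∫ k, (A * f k + B * g k + C) ∂μ = A * ∫ k, f k ∂μ + B * ∫ k, g k ∂μ + C := by
  have h : Integrable (fun k ↦ A * f k + B * g k) μ := (hf.const_mul A).add (hg.const_mul B)
  rw [integral_add h (integrable_const C), integral_add (hf.const_mul A) (hg.const_mul B),
    integral_const_mul, integral_const_mul]
  simp

lemma integral_typeStep_id (hx : x ∈ stdSimplex ℝ P.Ξ) (θ : ℕ) (i : Fin P.K) (m : ℕ) :
    ∫ k : ℕ, (k : ℝ) ∂P.typeStep θ x i m = θ * P.lam i + (1 - P.leaveRate x i) * m := by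
  induction m with
  | zero => rw [typeStep_zero hx, integral_id_poissonMeasure]; simp
  | succ m ih =>
    have := isProbabilityMeasure_typeStep hx θ i m
    have h1 := integrable_of_sq (integrable_sq_typeStep hx θ i m)
    have h2 : ∫ k : ℕ, ((k + 1 : ℕ) : ℝ) ∂P.typeStep θ x i m
        = θ * P.lam i + (1 - P.leaveRate x i) * m + 1 := by
      simp only [Nat.cast_add, Nat.cast_one]
      rw [integral_add h1 (integrable_const _), ih]; simp
    rw [(integrable_typeStep_succ (g := fun k ↦ (k : ℝ)) hx h1
      (by simpa using h1.add (integrable_const 1))).2, h2, ih]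
    push_cast
    ring

lemma integral_typeStep_sq (hx : x ∈ stdSimplex ℝ P.Ξ) (θ : ℕ) (i : Fin P.K) (m : ℕ) :
    ∫ k : ℕ, (k : ℝ) ^ 2 ∂P.typeStep θ x i m =
      (θ * P.lam i + (1 - P.leaveRate x i) * m) ^ 2 + θ * P.lam i +
        P.leaveRate x i * (1 - P.leaveRate x i) * m := by
  induction m with
  | zero => rw [typeStep_zero hx, integral_sq_poissonMeasure]; push_cast; ring
  | succ m ih =>
    have := isProbabilityMeasure_typeStep hx θ i m
    have hs := integrable_sq_typeStep hx θ i m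
    have h1 := integrable_of_sq hs
    have e (k : ℕ) : ((k + 1 : ℕ) : ℝ) ^ 2 = (k : ℝ) ^ 2 + (2 * k + 1) := by push_cast; ring
    have h3 : Integrable (fun k : ℕ ↦ 2 * (k : ℝ) + 1) (P.typeStep θ x i m) :=
      (h1.const_mul 2).add (integrable_const 1)
    have h2 : ∫ k : ℕ, ((k + 1 : ℕ) : ℝ) ^ 2 ∂P.typeStep θ x i m
        = ∫ k : ℕ, (k : ℝ) ^ 2 ∂P.typeStep θ x i m
          + (2 * (θ * P.lam i + (1 - P.leaveRate x i) * m) + 1) := by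
      simp only [e]
      rw [integral_add hs h3, integral_add (h1.const_mul 2) (integrable_const _),
        integral_const_mul, integral_typeStep_id hx]
      simp
    rw [(integrable_typeStep_succ (g := fun k ↦ (k : ℝ) ^ 2) hx hs
      (by simp only [e]; exact hs.add h3)).2, h2, ih]
    push_cast
    ring

/-! ### The transition law of all types -/

lemma isProbabilityMeasure_step (hx : x ∈ stdSimplex ℝ P.Ξ) (θ : ℕ) (n : Fin P.K → ℕ) :
    IsProbabilityMeasure (P.step θ x n) := by
  have (i : Fin P.K) := isProbabilityMeasure_typeStep hx θ i (n i)
  unfold step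
  infer_instance

/-- The marginals of the transition law. -/
lemma measurePreserving_eval_step (hx : x ∈ stdSimplex ℝ P.Ξ) (θ : ℕ) (n : Fin P.K → ℕ)
    (i : Fin P.K) :
    MeasurePreserving (Function.eval i) (P.step θ x n) (P.typeStep θ x i (n i)) := by
  have (i : Fin P.K) := isProbabilityMeasure_typeStep hx θ i (n i)
  exact measurePreserving_eval _ i

lemma integral_step_eval (hx : x ∈ stdSimplex ℝ P.Ξ) (θ : ℕ) (n : Fin P.K → ℕ) (i : Fin P.K)
    (g : ℕ → ℝ) : ∫ k, g (k i) ∂P.step θ x n = ∫ k, g k ∂P.typeStep θ x i (n i) := by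
  rw [← (measurePreserving_eval_step hx θ n i).map_eq, integral_map
    Measurable.of_discrete.aemeasurable Measurable.of_discrete.aestronglyMeasurable]

lemma integrable_step_sq (hx : x ∈ stdSimplex ℝ P.Ξ) (θ : ℕ) (n : Fin P.K → ℕ) (i : Fin P.K) :
    Integrable (fun k : Fin P.K → ℕ ↦ (k i : ℝ) ^ 2) (P.step θ x n) :=
  (measurePreserving_eval_step hx θ n i).integrable_comp_of_integrable
    (integrable_sq_typeStep hx θ i (n i))

/-- The effect of one more type `i` worker on the transition law of all types. -/
lemma step_add_single (hx : x ∈ stdSimplex ℝ P.Ξ) (θ : ℕ) (n : Fin P.K → ℕ) (i : Fin P.K) :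
    P.step θ x (n + Pi.single i 1) = ENNReal.ofReal (P.leaveRate x i) • P.step θ x n +
      ENNReal.ofReal (1 - P.leaveRate x i) • (P.step θ x n).map (· + Pi.single i 1) := by
  have (i : Fin P.K) (m : ℕ) := isProbabilityMeasure_typeStep hx θ i m
  unfold step
  refine Measure.pi_eq fun s _ ↦ ?_
  have hpre : (· + Pi.single i 1) ⁻¹' (univ.pi s) =
      univ.pi (Function.update s i ((· + 1) ⁻¹' s i)) := by
    ext k
    simp only [mem_preimage, mem_univ_pi]
    refine forall_congr' fun j ↦ ?_
    by_cases hj : j = i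
    · subst hj; simp
    · simp [hj]
  rw [Measure.add_apply, Measure.smul_apply, Measure.smul_apply,
    Measure.map_apply Measurable.of_discrete MeasurableSet.of_discrete, hpre, Measure.pi_pi,
    Measure.pi_pi, ← Finset.mul_prod_erase _ _ (Finset.mem_univ i),
    ← Finset.mul_prod_erase _ _ (Finset.mem_univ i),
    ← Finset.mul_prod_erase _ _ (Finset.mem_univ i)]
  have h1 : ∏ j ∈ Finset.univ.erase i, P.typeStep θ x j ((n + Pi.single i 1 : Fin P.K → ℕ) j) (s j) =
      ∏ j ∈ Finset.univ.erase i, P.typeStep θ x j (n j) (s j) :=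
    Finset.prod_congr rfl fun j hj ↦ by simp [Finset.ne_of_mem_erase hj]
  have h2 : ∏ j ∈ Finset.univ.erase i,
        P.typeStep θ x j (n j) (Function.update s i ((· + 1) ⁻¹' s i) j) =
      ∏ j ∈ Finset.univ.erase i, P.typeStep θ x j (n j) (s j) :=
    Finset.prod_congr rfl fun j hj ↦ by
      rw [Function.update_of_ne (Finset.ne_of_mem_erase hj)]
  rw [h1, h2, Pi.add_apply, Pi.single_eq_same, typeStep_succ hx, Measure.add_apply,
    Measure.smul_apply, Measure.smul_apply,
    Measure.map_apply Measurable.of_discrete MeasurableSet.of_discrete, Function.update_self]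
  simp only [smul_eq_mul]
  ring

/-! ### Contraction of Lipschitz functions -/

/-- `g` is `L`-Lipschitz for the `ℓ¹` distance on states: one more worker of any type changes it by
at most `L`. -/
def StepLipschitz (P : Platform) (L : ℝ) (g : (Fin P.K → ℕ) → ℝ) : Prop :=
  ∀ n i, |g (n + Pi.single i 1) - g n| ≤ L

lemma StepLipschitz.abs_sub_zero_le {L : ℝ} {g : (Fin P.K → ℕ) → ℝ} (hg : P.StepLipschitz L g)
    (n : Fin P.K → ℕ) : |g n - g 0| ≤ L * ∑ i, (n i : ℝ) := by
  induction hs : ∑ i, n i generalizing n with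
  | zero =>
    have : n = 0 := by
      funext i
      simpa using (Finset.sum_eq_zero_iff.1 hs) i (Finset.mem_univ i)
    simp [this]
  | succ s ih =>
    obtain ⟨i, hi⟩ : ∃ i, n i ≠ 0 := by
      by_contra! h
      simp [h] at hs
    obtain ⟨m, rfl⟩ : ∃ m : Fin P.K → ℕ, n = m + Pi.single i 1 := by
      refine ⟨n - Pi.single i 1, (tsub_add_cancel_of_le fun j ↦ ?_).symm⟩
      by_cases hj : j = i
      · subst hj; simpa using Nat.one_le_iff_ne_zero.2 hi
      · simp [hj]
    have hsum : ∑ j, (m + Pi.single i 1 : Fin P.K → ℕ) j = ∑ j, m j + 1 := by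
      simp [Finset.sum_add_distrib]
    have h1 := ih m (by omega)
    have h2 := hg m i
    have h3 : ∑ j, (((m + Pi.single i 1 : Fin P.K → ℕ) j : ℕ) : ℝ) = ∑ j, (m j : ℝ) + 1 := by
      exact_mod_cast hsum
    rw [h3]
    calc _ ≤ |g (m + Pi.single i 1) - g m| + |g m - g 0| := abs_sub_le _ _ _
      _ ≤ _ := by linarith

/-- A function of linear growth is integrable with respect to a measure with finite means. -/
lemma StepLipschitz.integrable {L : ℝ} {g : (Fin P.K → ℕ) → ℝ} (hg : P.StepLipschitz L g)
    {μ : Measure (Fin P.K → ℕ)} [IsFiniteMeasure μ]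
    (hμ : ∀ i, Integrable (fun n : Fin P.K → ℕ ↦ (n i : ℝ)) μ) : Integrable g μ := by
  refine (((integrable_finsetSum Finset.univ fun i _ ↦ hμ i).const_mul L).add
    (integrable_const |g 0|)).mono' Measurable.of_discrete.aestronglyMeasurable
    (ae_of_all _ fun n ↦ ?_)
  have h1 := hg.abs_sub_zero_le n
  have h2 := abs_sub_abs_le_abs_sub (g n) (g 0)
  simp only [Real.norm_eq_abs, Pi.add_apply]
  linarith

lemma StepLipschitz.integrable_step (hx : x ∈ stdSimplex ℝ P.Ξ) {L : ℝ}
    {g : (Fin P.K → ℕ) → ℝ} (hg : P.StepLipschitz L g) (θ : ℕ) (n : Fin P.K → ℕ) :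
    Integrable g (P.step θ x n) :=
  have := isProbabilityMeasure_step hx θ n
  hg.integrable fun i ↦ integrable_of_sq (φ := fun k : Fin P.K → ℕ ↦ k i)
    (integrable_step_sq hx θ n i)

/-- The transition operator contracts increments: the extra worker survives the period with
probability `1 - q_i ≤ ρ`. -/
lemma StepLipschitz.integral_step (hx : x ∈ stdSimplex ℝ P.Ξ) {ρ : ℝ}
    (hρ : ∀ i, 1 - P.leaveRate x i ≤ ρ) {L : ℝ} {g : (Fin P.K → ℕ) → ℝ}
    (hg : P.StepLipschitz L g) (θ : ℕ) :
    P.StepLipschitz (ρ * L) fun n ↦ ∫ k, g k ∂P.step θ x n := by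
  intro n i
  have := isProbabilityMeasure_step hx θ n
  have hL : 0 ≤ L := (abs_nonneg _).trans (hg n i)
  have h0 := hg.integrable_step hx θ n
  have hg' : P.StepLipschitz L fun k ↦ g (k + Pi.single i 1) := fun m j ↦ by
    simpa [add_right_comm] using hg (m + Pi.single i 1) j
  have h1 := hg'.integrable_step hx θ n
  have h1' : Integrable g ((P.step θ x n).map (· + Pi.single i 1)) :=
    (integrable_map_measure Measurable.of_discrete.aestronglyMeasurable
      Measurable.of_discrete.aemeasurable).2 h1
  have hq : 0 ≤ 1 - P.leaveRate x i := sub_nonneg.2 (leaveRate_le_one hx i)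
  have e : ∫ k, g k ∂P.step θ x (n + Pi.single i 1) - ∫ k, g k ∂P.step θ x n =
      (1 - P.leaveRate x i) * ∫ k, (g (k + Pi.single i 1) - g k) ∂P.step θ x n := by
    rw [step_add_single hx, integral_add_measure (h0.smul_measure ENNReal.ofReal_ne_top)
      (h1'.smul_measure ENNReal.ofReal_ne_top), integral_smul_measure, integral_smul_measure,
      integral_map Measurable.of_discrete.aemeasurable
      Measurable.of_discrete.aestronglyMeasurable, ENNReal.toReal_ofReal (leaveRate_pos hx i).le,
      ENNReal.toReal_ofReal hq, integral_sub h1 h0, smul_eq_mul, smul_eq_mul]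
    ring
  have h2 : |∫ k, (g (k + Pi.single i 1) - g k) ∂P.step θ x n| ≤ L := by
    have := norm_integral_le_of_norm_le_const (μ := P.step θ x n)
      (f := fun k ↦ g (k + Pi.single i 1) - g k) (C := L) (ae_of_all _ fun k ↦ hg k i)
    simpa using this
  rw [e, abs_mul, abs_of_nonneg hq]
  exact mul_le_mul (hρ i) h2 (abs_nonneg _) (hq.trans (hρ i))

/-! ### The law of the state after several periods -/

/-- The transition law as a Markov kernel. -/
def stepKernel (P : Platform) (θ : ℕ) (x : P.Ξ → ℝ) : Kernel (Fin P.K → ℕ) (Fin P.K → ℕ) :=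
  ⟨P.step θ x, Measurable.of_discrete⟩

lemma stateLaw_succ (θ : ℕ) (x : P.Ξ → ℝ) (c₀ : Fin P.K → ℕ) (t : ℕ) :
    P.stateLaw θ x c₀ (t + 1) = (P.stateLaw θ x c₀ t).bind (P.stepKernel θ x) := rfl

lemma isProbabilityMeasure_stateLaw (hx : x ∈ stdSimplex ℝ P.Ξ) (θ : ℕ) (c₀ : Fin P.K → ℕ)
    (t : ℕ) : IsProbabilityMeasure (P.stateLaw θ x c₀ t) := by
  induction t with
  | zero => exact Measure.dirac.isProbabilityMeasure
  | succ t ih =>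
    have : IsMarkovKernel (P.stepKernel θ x) := ⟨isProbabilityMeasure_step hx θ⟩
    rw [stateLaw_succ]
    infer_instance

lemma integral_stateLaw_succ {θ : ℕ} {c₀ : Fin P.K → ℕ} {t : ℕ}
    {g : (Fin P.K → ℕ) → ℝ} (hg : Integrable g (P.stateLaw θ x c₀ (t + 1))) :
    ∫ n, g n ∂P.stateLaw θ x c₀ (t + 1) = ∫ n, ∫ k, g k ∂P.step θ x n ∂P.stateLaw θ x c₀ t := by
  rw [stateLaw_succ, Measure.comp_eq_comp_const_apply] at hg ⊢
  rw [Kernel.integral_comp hg, Kernel.const_apply]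
  rfl

lemma integral_step_sq (hx : x ∈ stdSimplex ℝ P.Ξ) (θ : ℕ) (n : Fin P.K → ℕ) (i : Fin P.K) :
    ∫ k, (k i : ℝ) ^ 2 ∂P.step θ x n =
      (θ * P.lam i + (1 - P.leaveRate x i) * n i) ^ 2 + θ * P.lam i +
        P.leaveRate x i * (1 - P.leaveRate x i) * n i := by
  rw [integral_step_eval hx θ n i fun k ↦ (k : ℝ) ^ 2, integral_typeStep_sq hx]

lemma integrable_stateLaw_sq (hx : x ∈ stdSimplex ℝ P.Ξ) (θ : ℕ) (c₀ : Fin P.K → ℕ) (t : ℕ)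
    (i : Fin P.K) : Integrable (fun n ↦ (n i : ℝ) ^ 2) (P.stateLaw θ x c₀ t) := by
  induction t with
  | zero => exact integrable_dirac (by simp)
  | succ t ih =>
    have := isProbabilityMeasure_stateLaw hx θ c₀ t
    rw [stateLaw_succ, Measure.integrable_comp_iff Measurable.of_discrete.aestronglyMeasurable]
    refine ⟨ae_of_all _ fun n ↦ integrable_step_sq hx θ n i, ?_⟩
    have h1 := integrable_of_sq ih
    simp only [norm_pow, Real.norm_eq_abs, Nat.abs_cast]
    have e (n : Fin P.K → ℕ) : ∫ k, (k i : ℝ) ^ 2 ∂P.stepKernel θ x n =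
      (1 - P.leaveRate x i) ^ 2 * (n i : ℝ) ^ 2 + (2 * (θ * P.lam i) * (1 - P.leaveRate x i) +
        P.leaveRate x i * (1 - P.leaveRate x i)) * n i + ((θ * P.lam i) ^ 2 + θ * P.lam i) :=
      (integral_step_sq hx θ n i).trans (by ring)
    simp only [e]
    exact ((ih.const_mul _).add (h1.const_mul _)).add (integrable_const _)

lemma integrable_stateLaw_id (hx : x ∈ stdSimplex ℝ P.Ξ) (θ : ℕ) (c₀ : Fin P.K → ℕ) (t : ℕ)
    (i : Fin P.K) : Integrable (fun n ↦ (n i : ℝ)) (P.stateLaw θ x c₀ t) :=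
  integrable_of_sq (integrable_stateLaw_sq hx θ c₀ t i)

lemma integrable_stateLaw_sub_sq (hx : x ∈ stdSimplex ℝ P.Ξ) (θ : ℕ) (c₀ : Fin P.K → ℕ) (t : ℕ)
    (i : Fin P.K) (a : ℝ) : Integrable (fun n ↦ ((n i : ℝ) - a) ^ 2) (P.stateLaw θ x c₀ t) := by
  have := isProbabilityMeasure_stateLaw hx θ c₀ t
  have e (k : ℝ) : (k - a) ^ 2 = k ^ 2 + (-2 * a) * k + a ^ 2 := by ring
  simp only [e]
  exact ((integrable_stateLaw_sq hx θ c₀ t i).add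
    ((integrable_stateLaw_id hx θ c₀ t i).const_mul _)).add (integrable_const _)

lemma StepLipschitz.integrable_stateLaw (hx : x ∈ stdSimplex ℝ P.Ξ) {L : ℝ}
    {g : (Fin P.K → ℕ) → ℝ} (hg : P.StepLipschitz L g) (θ : ℕ) (c₀ : Fin P.K → ℕ) (t : ℕ) :
    Integrable g (P.stateLaw θ x c₀ t) :=
  have := isProbabilityMeasure_stateLaw hx θ c₀ t
  hg.integrable fun i ↦ integrable_stateLaw_id hx θ c₀ t i

/-- The means relax geometrically to the equilibrium `a`, where `θ λ_i = q_i a`. -/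
lemma integral_stateLaw_sub (hx : x ∈ stdSimplex ℝ P.Ξ) {θ : ℕ} {i : Fin P.K} {a : ℝ}
    (ha : θ * P.lam i = P.leaveRate x i * a) (c₀ : Fin P.K → ℕ) (t : ℕ) :
    ∫ n, ((n i : ℝ) - a) ∂P.stateLaw θ x c₀ t = (1 - P.leaveRate x i) ^ t * (c₀ i - a) := by
  induction t with
  | zero => simp [stateLaw]
  | succ t ih =>
    have h (n : Fin P.K → ℕ) : ∫ k, ((k i : ℝ) - a) ∂P.step θ x n =
        (1 - P.leaveRate x i) * ((n i : ℝ) - a) := by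
      have := isProbabilityMeasure_typeStep hx θ i (n i)
      rw [integral_step_eval hx θ n i fun k ↦ (k : ℝ) - a, integral_sub
        (integrable_of_sq (integrable_sq_typeStep hx θ i (n i))) (integrable_const _),
        integral_typeStep_id hx, ha]
      simp
      ring
    have := isProbabilityMeasure_stateLaw hx θ c₀ (t + 1)
    have h1 : Integrable (fun n ↦ (n i : ℝ) - a) (P.stateLaw θ x c₀ (t + 1)) :=
      (integrable_stateLaw_id hx θ c₀ _ i).sub (integrable_const _)
    rw [integral_stateLaw_succ h1]
    simp only [h]
    rw [integral_const_mul, ih]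
    ring

/-- The exact centred second moments: they relax geometrically to those of `Poisson a`. -/
lemma integral_stateLaw_sub_sq (hx : x ∈ stdSimplex ℝ P.Ξ) {θ : ℕ} {i : Fin P.K} {a : ℝ}
    (ha : θ * P.lam i = P.leaveRate x i * a) (c₀ : Fin P.K → ℕ) (t : ℕ) :
    ∫ n, ((n i : ℝ) - a) ^ 2 ∂P.stateLaw θ x c₀ t = a + (1 - P.leaveRate x i) ^ t * (c₀ i - a) +
      (1 - P.leaveRate x i) ^ (2 * t) * ((c₀ i - a) ^ 2 - (c₀ i - a) - a) := by
  induction t with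
  | zero => simp [stateLaw]; ring
  | succ t ih =>
    have h (n : Fin P.K → ℕ) : ∫ k, ((k i : ℝ) - a) ^ 2 ∂P.step θ x n =
        (1 - P.leaveRate x i) ^ 2 * ((n i : ℝ) - a) ^ 2 +
        P.leaveRate x i * (1 - P.leaveRate x i) * ((n i : ℝ) - a) +
        a * (1 - (1 - P.leaveRate x i) ^ 2) := by
      have := isProbabilityMeasure_typeStep hx θ i (n i)
      have hs := integrable_sq_typeStep hx θ i (n i)
      have e (k : ℕ) : ((k : ℝ) - a) ^ 2 = 1 * (k : ℝ) ^ 2 + (-2 * a) * k + a ^ 2 := by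
        ring
      rw [integral_step_eval hx θ n i fun k ↦ ((k : ℝ) - a) ^ 2]
      simp_rw [e]
      rw [integral_affine_combination hs (integrable_of_sq (φ := fun k ↦ k) hs),
        integral_typeStep_id hx, integral_typeStep_sq hx, ha]
      ring
    have := isProbabilityMeasure_stateLaw hx θ c₀ t
    have h1 := integrable_stateLaw_sub_sq hx θ c₀ t i a
    have h2 : Integrable (fun n ↦ (n i : ℝ) - a) (P.stateLaw θ x c₀ t) :=
      (integrable_stateLaw_id hx θ c₀ t i).sub (integrable_const _)
    rw [integral_stateLaw_succ (integrable_stateLaw_sub_sq hx θ c₀ _ i a)]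
    simp only [h]
    rw [integral_affine_combination h1 h2, ih, integral_stateLaw_sub hx ha]
    ring

/-- The expectation of a Lipschitz function of the state converges as time goes to infinity. -/
lemma StepLipschitz.exists_tendsto (hx : x ∈ stdSimplex ℝ P.Ξ) {L : ℝ}
    {g : (Fin P.K → ℕ) → ℝ} (hg : P.StepLipschitz L g) (θ : ℕ) (c₀ : Fin P.K → ℕ) :
    ∃ v, Tendsto (fun t ↦ ∫ n, g n ∂P.stateLaw θ x c₀ t) atTop (𝓝 v) := by
  have : Nonempty (Fin P.K) := ⟨⟨0, P.K_pos⟩⟩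
  obtain ⟨i₀, hi₀⟩ := Finite.exists_min fun i ↦ P.leaveRate x i
  set ρ := 1 - P.leaveRate x i₀ with hρdef
  have hρ (i : Fin P.K) : 1 - P.leaveRate x i ≤ ρ := by linarith [hi₀ i]
  have hρ1 : ρ < 1 := by linarith [leaveRate_pos hx i₀]
  set G : ℕ → (Fin P.K → ℕ) → ℝ := fun t ↦ (fun h n ↦ ∫ k, h k ∂P.step θ x n)^[t] g with hG
  have hGs (t : ℕ) (n : Fin P.K → ℕ) : G (t + 1) n = ∫ k, G t k ∂P.step θ x n := by
    simp only [hG, Function.iterate_succ_apply']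
  have hLip (t : ℕ) : P.StepLipschitz (ρ ^ t * L) (G t) := by
    induction t with
    | zero => simpa [hG] using hg
    | succ t ih =>
      have := ih.integral_step hx hρ θ
      rw [show ρ ^ (t + 1) * L = ρ * (ρ ^ t * L) by ring, show G (t + 1) = _ from funext (hGs t)]
      exact this
  -- Backward evolution of the function agrees with forward evolution of the law.
  have hdual (t s : ℕ) : ∫ n, G s n ∂P.stateLaw θ x c₀ t = G (t + s) c₀ := by
    induction t generalizing s with
    | zero => simp [stateLaw]
    | succ t ih =>
      rw [integral_stateLaw_succ ((hLip s).integrable_stateLaw hx θ c₀ _)]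
      simp only [← hGs]
      rw [ih, add_right_comm, add_assoc]
  have hval (t : ℕ) : ∫ n, g n ∂P.stateLaw θ x c₀ t = G t c₀ := hdual t 0
  simp only [hval]
  have hc := isProbabilityMeasure_step hx θ c₀
  have hint : Integrable (fun k : Fin P.K → ℕ ↦ ∑ i, (k i : ℝ)) (P.step θ x c₀) :=
    integrable_finsetSum _ fun i _ ↦ integrable_of_sq (φ := fun k : Fin P.K → ℕ ↦ k i)
      (integrable_step_sq hx θ c₀ i)
  refine cauchySeq_tendsto_of_complete (cauchySeq_of_le_geometric ρ
    (L * ∫ k, (∑ i, (k i : ℝ) + ∑ i, (c₀ i : ℝ)) ∂P.step θ x c₀) hρ1 fun t ↦ ?_)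
  rw [dist_comm, Real.dist_eq, hGs]
  have h1 : ∫ k, G t k ∂P.step θ x c₀ - G t c₀ = ∫ k, (G t k - G t c₀) ∂P.step θ x c₀ := by
    rw [integral_sub ((hLip t).integrable_step hx θ c₀) (integrable_const _)]
    simp
  rw [h1, show ∀ S : ℝ, L * S * ρ ^ t = ρ ^ t * L * S from fun S ↦ by ring, ← integral_const_mul]
  rw [← Real.norm_eq_abs]
  refine norm_integral_le_of_norm_le ((hint.add (integrable_const (∑ i, (c₀ i : ℝ)))).const_mul _)
    (ae_of_all _ fun k ↦ ?_)
  have hk := (hLip t).abs_sub_zero_le k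
  have hk' := (hLip t).abs_sub_zero_le c₀
  rw [abs_sub_comm] at hk'
  calc ‖G t k - G t c₀‖ ≤ |G t k - G t 0| + |G t 0 - G t c₀| := abs_sub_le _ _ _
    _ ≤ _ := by rw [mul_add]; exact add_le_add hk hk'

/-! ### The long-run average profit -/

/-- By concavity and monotonicity, the increments of `R` along `ℕ / θ` are at most the first. -/
lemma abs_R_succ_sub_le (P : Platform) {θ : ℕ} (hθ : 1 ≤ θ) (N : ℕ) :
    |P.R ((N + 1 : ℕ) / (θ : ℝ)) - P.R (N / (θ : ℝ))| ≤ P.R (1 / (θ : ℝ)) - P.R 0 := by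
  have hθ0 : (0 : ℝ) < θ := by exact_mod_cast hθ
  have hN : (0 : ℝ) ≤ N / (θ : ℝ) := by positivity
  have hd : (0 : ℝ) < 1 / (θ : ℝ) := by positivity
  have hmono : P.R (N / (θ : ℝ)) ≤ P.R ((N + 1 : ℕ) / (θ : ℝ)) := P.R_monotone hN
    (show (0 : ℝ) ≤ _ by positivity) (by push_cast; gcongr; linarith)
  rw [abs_of_nonneg (sub_nonneg.2 hmono)]
  rcases Nat.eq_zero_or_pos N with rfl | hNpos
  · simp
  set y : ℝ := N / (θ : ℝ) with hy
  set d : ℝ := 1 / (θ : ℝ) with hd'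
  have hyd : ((N + 1 : ℕ) / (θ : ℝ)) = y + d := by push_cast; rw [hy, hd']; ring
  have hypos : 0 < y := by positivity
  rw [hyd]
  -- `d` and `y` are symmetric convex combinations of `0` and `y + d`.
  have h1 := P.R_concave.2 (mem_Ici.2 le_rfl) (mem_Ici.2 (by positivity : (0 : ℝ) ≤ y + d))
    (by positivity : 0 ≤ y / (y + d)) (by positivity : 0 ≤ d / (y + d)) (by field_simp)
  have h2 := P.R_concave.2 (mem_Ici.2 le_rfl) (mem_Ici.2 (by positivity : (0 : ℝ) ≤ y + d))
    (by positivity : 0 ≤ d / (y + d)) (by positivity : 0 ≤ y / (y + d)) (by field_simp; ring)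
  have e1 : (y / (y + d)) • (0 : ℝ) + (d / (y + d)) • (y + d) = d := by
    simp only [smul_eq_mul]; field_simp; ring
  have e2 : (d / (y + d)) • (0 : ℝ) + (y / (y + d)) • (y + d) = y := by
    simp only [smul_eq_mul]; field_simp; ring
  rw [e1] at h1
  rw [e2] at h2
  have e3 : y / (y + d) = 1 - d / (y + d) := by field_simp; ring
  simp only [smul_eq_mul, e3] at h1 h2
  linarith

lemma stepLipschitz_profit (P : Platform) {θ : ℕ} (hθ : 1 ≤ θ) (x : P.Ξ → ℝ) :
    P.StepLipschitz (P.R (1 / (θ : ℝ)) - P.R 0 + |P.meanReward x| / θ) (P.profit θ x) := by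
  intro n i
  have hsum : ∑ j, (n + Pi.single i 1 : Fin P.K → ℕ) j = ∑ j, n j + 1 := by
    simp [Finset.sum_add_distrib]
  unfold profit
  rw [hsum]
  have h1 := abs_R_succ_sub_le P hθ (∑ j, n j)
  have e : ∀ A B : ℝ, A - ((∑ j, n j + 1 : ℕ) : ℝ) / θ * P.meanReward x
      - (B - ((∑ j, n j : ℕ) : ℝ) / θ * P.meanReward x) = (A - B) - P.meanReward x / θ := by
    intro A B
    rw [Nat.cast_add]
    push_cast
    ring
  rw [e]
  refine (abs_sub _ _).trans (add_le_add h1 (le_of_eq ?_))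
  rw [abs_div, Nat.abs_cast]

/-- A global quadratic lower bound on `R` around the fluid mass turns into a lower bound on the
long-run average profit: in the limit, `N(t) / θ` has mean `∑ i, n i`, and the sum over the types
of the variances of `N_i(t) / θ` is `(∑ i, n i) / θ`. -/
lemma exists_longRunAverage {n : Fin P.K → ℝ} (hxn : P.FluidFeasible x n) {b C e : ℝ} (hC : 0 ≤ C)
    (hR : ∀ y, 0 ≤ y → P.R (∑ i, n i) + b * (y - ∑ i, n i) - C * (y - ∑ i, n i) ^ 2 - e ≤ P.R y)
    {θ : ℕ} (hθ : 1 ≤ θ) (c₀ : Fin P.K → ℕ) :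
    ∃ v, P.IsLongRunAverage θ x c₀ v ∧
      P.fluidObjective x n - C * P.K * (∑ i, n i) / θ - e ≤ v := by
  obtain ⟨hx, -, hn⟩ := hxn
  have hθ0 : (0 : ℝ) < θ := by exact_mod_cast hθ
  have hLip := stepLipschitz_profit P hθ x
  obtain ⟨v, hv⟩ := hLip.exists_tendsto hx θ c₀
  refine ⟨v, ⟨fun t ↦ hLip.integrable_stateLaw hx θ c₀ t, ?_⟩, ?_⟩
  · have h := ((tendsto_add_atTop_iff_nat 1).2 hv).cesaro
    refine h.congr fun T ↦ ?_
    rw [Finset.range_eq_Ico, Finset.sum_Ico_add' (fun t ↦ ∫ n, P.profit θ x n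
      ∂P.stateLaw θ x c₀ t), one_div]
    rfl
  have ha (i : Fin P.K) : θ * (P.lam i : ℝ) = P.leaveRate x i * (θ * n i) := by
    rw [hn i]; unfold leaveRate; ring
  set β := b - P.meanReward x with hβ
  -- The bound on `R`, in terms of the centred counts; by Cauchy–Schwarz, the square of their sum
  -- is at most `K` times the sum of their squares, so no covariances are needed.
  have hpt (k : Fin P.K → ℕ) : P.fluidObjective x n - e + β / θ * ∑ i, ((k i : ℝ) - θ * n i)
      - C * P.K / θ ^ 2 * ∑ i, ((k i : ℝ) - θ * n i) ^ 2 ≤ P.profit θ x k := by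
    have h1 := hR ((∑ i, k i : ℕ) / (θ : ℝ)) (by positivity)
    have h2 : ((∑ i, k i : ℕ) : ℝ) / θ - ∑ i, n i = (∑ i, ((k i : ℝ) - θ * n i)) / θ := by
      rw [Finset.sum_sub_distrib, ← Finset.mul_sum]
      push_cast
      field_simp
    have h3 : (∑ i, ((k i : ℝ) - θ * n i)) ^ 2 ≤ P.K * ∑ i, ((k i : ℝ) - θ * n i) ^ 2 := by
      simpa using sq_sum_le_card_mul_sum_sq (s := Finset.univ)
        (f := fun i : Fin P.K ↦ (k i : ℝ) - θ * n i)
    have h4 := mul_le_mul_of_nonneg_left h3 (by positivity : 0 ≤ C / (θ : ℝ) ^ 2)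
    have h5 : ((∑ i, k i : ℕ) : ℝ) / θ = (∑ i, ((k i : ℝ) - θ * n i)) / θ + ∑ i, n i := by
      linarith
    unfold profit fluidObjective
    rw [h2] at h1
    rw [h5] at h1 ⊢
    set S := ∑ i, ((k i : ℝ) - θ * n i)
    set Q := ∑ i, ((k i : ℝ) - θ * n i) ^ 2
    have h6 : C * (S / θ) ^ 2 ≤ C * P.K / θ ^ 2 * Q := by
      calc C * (S / θ) ^ 2 = C / θ ^ 2 * S ^ 2 := by ring
        _ ≤ _ := h4
        _ = _ := by ring
    have h7 : β / θ * S = b * (S / θ) - P.meanReward x * (S / θ) := by rw [hβ]; ring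
    rw [h7]
    linarith
  -- The expectation at time `t`, by the exact moments of the chain.
  have hexp (t : ℕ) : P.fluidObjective x n - e
      + β / θ * ∑ i, (1 - P.leaveRate x i) ^ t * (c₀ i - θ * n i)
      - C * P.K / θ ^ 2 * ∑ i, (θ * n i + (1 - P.leaveRate x i) ^ t * (c₀ i - θ * n i) +
      (1 - P.leaveRate x i) ^ (2 * t) * ((c₀ i - θ * n i) ^ 2 - (c₀ i - θ * n i) - θ * n i)) ≤
      ∫ k, P.profit θ x k ∂P.stateLaw θ x c₀ t := by
    have := isProbabilityMeasure_stateLaw hx θ c₀ t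
    have i1 (i : Fin P.K) : Integrable (fun k ↦ (k i : ℝ) - θ * n i) (P.stateLaw θ x c₀ t) :=
      (integrable_stateLaw_id hx θ c₀ t i).sub (integrable_const _)
    have i2 (i : Fin P.K) := integrable_stateLaw_sub_sq hx θ c₀ t i (θ * n i)
    have j1 : Integrable (fun k : Fin P.K → ℕ ↦ ∑ i, ((k i : ℝ) - θ * n i))
      (P.stateLaw θ x c₀ t) := integrable_finsetSum _ fun i _ ↦ i1 i
    have j2 : Integrable (fun k : Fin P.K → ℕ ↦ ∑ i, ((k i : ℝ) - θ * n i) ^ 2)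
      (P.stateLaw θ x c₀ t) := integrable_finsetSum _ fun i _ ↦ i2 i
    have h := integral_mono (((j1.const_mul (β / θ)).add
      (j2.const_mul (-(C * P.K / (θ : ℝ) ^ 2)))).add
      (integrable_const (P.fluidObjective x n - e)))
      (hLip.integrable_stateLaw hx θ c₀ t) fun k ↦ (by
        simp only [Pi.add_apply]; linarith [hpt k])
    simp only [Pi.add_apply] at h
    rw [integral_affine_combination j1 j2, integral_finsetSum _ fun i _ ↦ i1 i,
      integral_finsetSum _ fun i _ ↦ i2 i] at h
    simp only [integral_stateLaw_sub hx (ha _), integral_stateLaw_sub_sq hx (ha _)] at h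
    linarith
  have hpow (i : Fin P.K) : Tendsto (fun t ↦ (1 - P.leaveRate x i) ^ t) atTop (𝓝 0) :=
    tendsto_pow_atTop_nhds_zero_of_lt_one (sub_nonneg.2 (leaveRate_le_one hx i))
      (by linarith [leaveRate_pos hx i])
  have hpow2 (i : Fin P.K) : Tendsto (fun t ↦ (1 - P.leaveRate x i) ^ (2 * t)) atTop (𝓝 0) :=
    (hpow i).comp (tendsto_id.const_mul_atTop' two_pos)
  have hlim : Tendsto (fun t ↦ P.fluidObjective x n - e
      + β / θ * ∑ i, (1 - P.leaveRate x i) ^ t * (c₀ i - θ * n i)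
      - C * P.K / θ ^ 2 * ∑ i, (θ * n i + (1 - P.leaveRate x i) ^ t * (c₀ i - θ * n i) +
      (1 - P.leaveRate x i) ^ (2 * t) * ((c₀ i - θ * n i) ^ 2 - (c₀ i - θ * n i) - θ * n i)))
      atTop (𝓝 (P.fluidObjective x n - e + β / θ * ∑ i, 0 * (c₀ i - θ * n i)
      - C * P.K / θ ^ 2 * ∑ i, (θ * n i + 0 * (c₀ i - θ * n i) +
        0 * ((c₀ i - θ * n i) ^ 2 - (c₀ i - θ * n i) - θ * n i)))) :=
    (((tendsto_finsetSum _ fun i _ ↦ (hpow i).mul_const _).const_mul _).const_add _).sub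
      ((tendsto_finsetSum _ fun i _ ↦ (((hpow i).mul_const _).const_add _).add
        ((hpow2 i).mul_const _)).const_mul _)
  refine le_of_eq_of_le ?_ (le_of_tendsto_of_tendsto' hlim hv hexp)
  simp only [zero_mul, Finset.sum_const_zero, mul_zero, add_zero]
  rw [← Finset.mul_sum]
  field_simp
  ring

/-! ### The fluid problem -/

lemma fluidFeasible_iff {n : Fin P.K → ℝ} :
    P.FluidFeasible x n ↔ x ∈ stdSimplex ℝ P.Ξ ∧ ∀ i, n i = P.lam i / P.leaveRate x i := by
  refine and_congr_right fun hx ↦ ⟨fun h i ↦ ?_, fun h ↦ ⟨fun i ↦ ?_, fun i ↦ ?_⟩⟩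
  · rw [eq_div_iff (leaveRate_pos hx i).ne', h.2 i]; rfl
  · rw [h i]; exact div_nonneg (P.lam i).2 (leaveRate_pos hx i).le
  · rw [h i]; exact (div_mul_cancel₀ _ (leaveRate_pos hx i).ne').symm

lemma sum_lam_le {n : Fin P.K → ℝ} (h : P.FluidFeasible x n) :
    ∑ i, (P.lam i : ℝ) ≤ ∑ i, n i := by
  obtain ⟨hx, hn⟩ := fluidFeasible_iff.1 h
  refine Finset.sum_le_sum fun i _ ↦ ?_
  rw [hn i]
  exact le_div_self (P.lam i).2 (leaveRate_pos hx i) (leaveRate_le_one hx i)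

lemma sum_le_LamBar {n : Fin P.K → ℝ} (h : P.FluidFeasible x n) : ∑ i, n i ≤ P.LamBar := by
  obtain ⟨hx, hn⟩ := fluidFeasible_iff.1 h
  refine Finset.sum_le_sum fun i _ ↦ ?_
  rw [hn i]
  exact div_le_div_of_nonneg_left (P.lam i).2 (P.ℓ_pos i _) (le_leaveRate hx i)

lemma sum_eq_zero {n : Fin P.K → ℝ} (h : P.FluidFeasible x n)
    (h0 : ∑ i, (P.lam i : ℝ) = 0) : ∑ i, n i = 0 := by
  obtain ⟨hx, hn⟩ := fluidFeasible_iff.1 h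
  refine Finset.sum_eq_zero fun i _ ↦ ?_
  have hi : (P.lam i : ℝ) = 0 :=
    (Finset.sum_eq_zero_iff_of_nonneg fun i _ ↦ (P.lam i).2).1 h0 i (Finset.mem_univ i)
  rw [hn i, hi, zero_div]

lemma continuousOn_fluidObjective (P : Platform) :
    ContinuousOn (fun x ↦ P.fluidObjective x fun i ↦ P.lam i / P.leaveRate x i)
      (stdSimplex ℝ P.Ξ) := by
  have hq (i : Fin P.K) : Continuous fun x ↦ P.leaveRate x i := by
    unfold leaveRate; fun_prop
  have hm : Continuous fun x ↦ P.meanReward x := by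
    unfold meanReward; fun_prop
  have hN : ContinuousOn (fun x ↦ ∑ i, (P.lam i : ℝ) / P.leaveRate x i) (stdSimplex ℝ P.Ξ) :=
    continuousOn_finsetSum _ fun i _ ↦
      continuousOn_const.div (hq i).continuousOn fun x hx ↦ (leaveRate_pos hx i).ne'
  refine ContinuousOn.sub ?_ (hm.continuousOn.mul hN)
  rcases (Finset.sum_nonneg fun i _ ↦ (P.lam i).2 : 0 ≤ ∑ i, (P.lam i : ℝ)).eq_or_lt
    with h0 | hpos
  · -- `R` may jump at `0`, but without arrivals the mass is `0` for every `x`.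
    refine continuousOn_const (c := P.R 0) |>.congr fun x hx ↦ ?_
    exact congrArg P.R (sum_eq_zero (fluidFeasible_iff.2 ⟨hx, fun _ ↦ rfl⟩) h0.symm)
  · exact P.R_differentiable.continuousOn.comp hN fun x hx ↦
      hpos.trans_le (sum_lam_le (fluidFeasible_iff.2 ⟨hx, fun _ ↦ rfl⟩))

lemma exists_isFluidOptimal (P : Platform) : ∃ x, P.IsFluidOptimal x := by
  have hne : (stdSimplex ℝ P.Ξ).Nonempty := ⟨_, single_mem_stdSimplex ℝ P.rMax⟩
  obtain ⟨x, hx, hmax⟩ := (isCompact_stdSimplex ℝ P.Ξ).exists_isMaxOn hne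
    P.continuousOn_fluidObjective
  refine ⟨x, _, fluidFeasible_iff.2 ⟨hx, fun _ ↦ rfl⟩, fun y m hy ↦ ?_⟩
  obtain ⟨hy', hm⟩ := fluidFeasible_iff.1 hy
  rw [funext hm]
  exact hmax hy'

lemma IsFluidOptimal.exists_eq_fluidValue (h : P.IsFluidOptimal x) :
    ∃ n, P.FluidFeasible x n ∧ P.fluidObjective x n = P.fluidValue := by
  obtain ⟨n, hn, hmax⟩ := h
  have hg : IsGreatest {z | ∃ x n, P.FluidFeasible x n ∧ z = P.fluidObjective x n}
      (P.fluidObjective x n) := by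
    refine ⟨⟨x, n, hn, rfl⟩, ?_⟩
    rintro _ ⟨y, m, hy, rfl⟩
    exact hmax y m hy
  exact ⟨n, hn, hg.csSup_eq.symm⟩

/-! ### Quadratic lower bounds on the revenue function -/

lemma LamBar_nonneg (P : Platform) : 0 ≤ P.LamBar :=
  Finset.sum_nonneg fun i _ ↦ div_nonneg (P.lam i).2 (P.ℓ_pos i _).le

/-- The quadratic lower bound for Lipschitz `R`. The value `R 0` may lie below the Lipschitz bound;
there the quadratic term alone is at least `R N`. The weight `s > 0` is free. -/
lemma lipschitz_lower_bound {L : ℝ≥0} (hL : LipschitzOnWith L P.R (Ioi 0)) {A B N s : ℝ}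
    (hA : 0 < A) (hAN : A ≤ N) (hNB : N ≤ B) (hs : 0 < s) {y : ℝ} (hy : 0 ≤ y) :
    P.R N + 0 * (y - N) - (L / 2 * s + P.R B / A ^ 2) * (y - N) ^ 2 - L / 2 / s ≤ P.R y := by
  have hN : 0 < N := hA.trans_le hAN
  have hRB : P.R N ≤ P.R B := P.R_monotone hN.le (hN.le.trans hNB) hNB
  have hRN := P.R_nonneg N hN.le
  have hC : 0 ≤ P.R B / A ^ 2 := div_nonneg (hRN.trans hRB) (by positivity)
  have hLs : 0 ≤ (L : ℝ) / 2 / s := by positivity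
  have hLs' : 0 ≤ (L : ℝ) / 2 * s := by positivity
  rcases hy.eq_or_lt with rfl | hy
  · have h1 : P.R B ≤ P.R B / A ^ 2 * (0 - N) ^ 2 := by
      calc P.R B = P.R B / A ^ 2 * A ^ 2 := by field_simp
        _ ≤ P.R B / A ^ 2 * (0 - N) ^ 2 := by
          refine mul_le_mul_of_nonneg_left ?_ hC
          nlinarith
    have h2 := P.R_nonneg 0 le_rfl
    have h3 := mul_nonneg hLs' (sq_nonneg (0 - N))
    linarith
  · have h1 := hL.dist_le_mul N hN y hy
    rw [Real.dist_eq, Real.dist_eq, abs_sub_comm N y] at h1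
    have h2 := (abs_le.1 h1).2
    -- `|u| ≤ (s u² + 1 / s) / 2`
    have h3 : |y - N| ≤ s / 2 * (y - N) ^ 2 + 1 / 2 / s := by
      have h4 : 0 ≤ s / 2 * (|y - N| - 1 / s) ^ 2 := by positivity
      have h5 : s / 2 * (|y - N| - 1 / s) ^ 2 =
          s / 2 * |y - N| ^ 2 - |y - N| + 1 / 2 / s := by field_simp; ring
      rw [h5, sq_abs] at h4
      linarith
    have h6 := mul_le_mul_of_nonneg_left h3 L.2
    have h7 := mul_nonneg hC (sq_nonneg (y - N))
    have h8 : (L : ℝ) * (s / 2 * (y - N) ^ 2 + 1 / 2 / s) =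
      L / 2 * s * (y - N) ^ 2 + L / 2 / s := by ring
    have h9 : P.R N - P.R y ≤ L / 2 * s * (y - N) ^ 2 + L / 2 / s :=
      h2.trans (h6.trans_eq h8)
    linarith

/-- For twice continuously differentiable `R`, the second-order Taylor bound holds globally on
`[0, ∞)`, with one constant for all base points `N ∈ [A, B]`. Near `N` the constant comes from a
bound on `R''`; to the left of `A / 2` it comes from `R ≥ 0` and to the right of `2 B` from
monotonicity, `|y - N|` being bounded below in both regions. -/
lemma exists_taylor_lower_bound (hR : ContDiffOn ℝ 2 P.R (Ioi 0)) {A B : ℝ} (hA : 0 < A)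
    (hAB : A ≤ B) : ∃ C, 0 ≤ C ∧ ∀ N ∈ Icc A B, ∀ y, 0 ≤ y →
      P.R N + deriv P.R N * (y - N) - C * (y - N) ^ 2 - 0 ≤ P.R y := by
  have hd : ContDiffOn ℝ 1 (deriv P.R) (Ioi 0) :=
    ((contDiffOn_succ_iff_deriv_of_isOpen (n := 1) isOpen_Ioi).1 hR).2.2
  have hd2 : ContinuousOn (deriv (deriv P.R)) (Ioi 0) :=
    hd.continuousOn_deriv_of_isOpen isOpen_Ioi le_rfl
  have hJ : Icc (A / 2) (2 * B) ⊆ Ioi 0 := fun z hz ↦ (by linarith [hz.1] : 0 < z)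
  obtain ⟨D₁, hD₁⟩ := isCompact_Icc.exists_bound_of_continuousOn (hd.continuousOn.mono hJ)
  obtain ⟨D₂, hD₂⟩ := isCompact_Icc.exists_bound_of_continuousOn (hd2.mono hJ)
  have hAJ : A ∈ Icc (A / 2) (2 * B) := ⟨by linarith, by linarith⟩
  have hD₁0 : 0 ≤ D₁ := (norm_nonneg _).trans (hD₁ A hAJ)
  have hD₂0 : 0 ≤ D₂ := (norm_nonneg _).trans (hD₂ A hAJ)
  have hB : 0 < B := hA.trans_le hAB
  have hRB := P.R_nonneg B hB.le
  have hc1 : 0 ≤ 4 * P.R B / A ^ 2 := by positivity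
  have hc2 : 0 ≤ D₁ / A := by positivity
  refine ⟨D₂ + 4 * P.R B / A ^ 2 + D₁ / A, by positivity, fun N hN y hy ↦ ?_⟩
  have hN0 : 0 < N := hA.trans_le hN.1
  have hNJ : N ∈ Icc (A / 2) (2 * B) := ⟨by linarith [hN.1], by linarith [hN.2]⟩
  have hsq := sq_nonneg (y - N)
  have t1 := mul_nonneg hD₂0 hsq
  have t2 := mul_nonneg hc1 hsq
  have t3 := mul_nonneg hc2 hsq
  have hRN : P.R N ≤ P.R B := P.R_monotone hN0.le hB.le hN.2
  have hdiff (z : ℝ) (hz : 0 < z) : HasDerivAt P.R (deriv P.R z) z :=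
    (P.R_differentiable.differentiableAt (Ioi_mem_nhds hz)).hasDerivAt
  have hdiff2 (z : ℝ) (hz : 0 < z) : HasDerivAt (deriv P.R) (deriv (deriv P.R) z) z :=
    ((hd.differentiableOn one_ne_zero).differentiableAt (Ioi_mem_nhds hz)).hasDerivAt
  have hd0 : 0 ≤ deriv P.R N := by
    rw [← derivWithin_of_mem_nhds (Ici_mem_nhds hN0)]
    exact P.R_monotone.derivWithin_nonneg
  have expand : ∀ u : ℝ, (D₂ + 4 * P.R B / A ^ 2 + D₁ / A) * u = D₂ * u + 4 * P.R B / A ^ 2 * u +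
    D₁ / A * u := fun u ↦ by ring
  rw [expand]
  rcases lt_or_ge y (A / 2) with hyA | hyA
  · have h1 : P.R B ≤ 4 * P.R B / A ^ 2 * (y - N) ^ 2 := by
      calc P.R B = 4 * P.R B / A ^ 2 * (A / 2) ^ 2 := by field_simp; ring
        _ ≤ _ := by
          refine mul_le_mul_of_nonneg_left ?_ hc1
          nlinarith [hN.1]
    have h2 : deriv P.R N * (y - N) ≤ 0 :=
      mul_nonpos_of_nonneg_of_nonpos hd0 (by linarith [hN.1])
    linarith [P.R_nonneg y hy]
  rcases lt_or_ge (2 * B) y with hyB | hyB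
  · have h1 : P.R N ≤ P.R y := P.R_monotone hN0.le hy (by linarith [hN.2])
    have h2 : deriv P.R N ≤ D₁ := (le_abs_self _).trans (hD₁ N hNJ)
    have h3 : A ≤ y - N := by linarith [hN.2]
    have h4 : deriv P.R N * (y - N) ≤ D₁ / A * (y - N) ^ 2 := by
      calc deriv P.R N * (y - N) ≤ D₁ * (y - N) :=
            mul_le_mul_of_nonneg_right h2 (by linarith)
        _ = D₁ / A * (A * (y - N)) := by field_simp
        _ ≤ D₁ / A * (y - N) ^ 2 := by
          refine mul_le_mul_of_nonneg_left ?_ hc2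
          nlinarith
    linarith
  have hyJ : y ∈ Icc (A / 2) (2 * B) := ⟨hyA, hyB⟩
  have hseg : uIcc N y ⊆ Icc (A / 2) (2 * B) := uIcc_subset_Icc hNJ hyJ
  -- On the segment, `R'` stays within `D₂ |y - N|` of `R' N`.
  have h1 (z : ℝ) (hz : z ∈ uIcc N y) : ‖deriv P.R z - deriv P.R N‖ ≤ D₂ * ‖y - N‖ := by
    refine (Convex.norm_image_sub_le_of_norm_hasDerivWithin_le
      (fun w hw ↦ (hdiff2 w (hJ (hseg hw))).hasDerivWithinAt)
      (fun w hw ↦ hD₂ w (hseg hw)) (convex_uIcc N y) left_mem_uIcc hz).trans ?_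
    exact mul_le_mul_of_nonneg_left (abs_sub_left_of_mem_uIcc hz) hD₂0
  have h2 := Convex.norm_image_sub_le_of_norm_hasDerivWithin_le
    (f := fun z ↦ P.R z - deriv P.R N * z) (s := uIcc N y)
    (fun w hw ↦ ((hdiff w (hJ (hseg hw))).sub
      ((hasDerivAt_id w).const_mul (deriv P.R N))).hasDerivWithinAt)
    (fun w hw ↦ by simpa using h1 w hw) (convex_uIcc N y) left_mem_uIcc right_mem_uIcc
  rw [mul_assoc, Real.norm_eq_abs, Real.norm_eq_abs, ← sq, sq_abs] at h2
  have h3 := (abs_le.1 h2).1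
  linarith

end Platform

end

theorem theorem1 (P : Platform) :
    -- the fluid problem has an optimal solution
    (∃ x, P.IsFluidOptimal x) ∧
    -- the general bound
    ((∃ L : ℝ≥0, LipschitzOnWith L P.R (Set.Ioi 0)) →
      ∃ CL : ℝ, 0 < CL ∧ ∀ x, P.IsFluidOptimal x → ∀ θ : ℕ, 1 ≤ θ → ∀ c₀ : Fin P.K → ℕ,
      ∃ v, P.IsLongRunAverage θ x c₀ v ∧ P.fluidValue - CL / Real.sqrt θ ≤ v) ∧
    -- the improved bound
    (ContDiffOn ℝ 2 P.R (Set.Ioi 0) → ∀ α : ℝ, 0 < α →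
      ∃ C : ℝ, 0 < C ∧ ∀ x, P.IsFluidOptimal x → ∀ θ : ℕ, 1 ≤ θ →
        (∀ y ∈ Set.Ico (1 / (θ : ℝ)) P.LamBar, -((θ : ℝ) ^ α) ≤ deriv (deriv P.R) y) →
        ∀ c₀ : Fin P.K → ℕ,
          ∃ v, P.IsLongRunAverage θ x c₀ v ∧ P.fluidValue - C / θ ≤ v) := by
  refine ⟨P.exists_isFluidOptimal, ?_⟩
  rcases (Finset.sum_nonneg fun i _ ↦ (P.lam i).2 : 0 ≤ ∑ i, (P.lam i : ℝ)).eq_or_lt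
    with h0 | hpos
  · -- Without arrivals the platform empties, and the long-run average is the fluid value.
    have hexact (x : P.Ξ → ℝ) (hx : P.IsFluidOptimal x) (θ : ℕ) (hθ : 1 ≤ θ)
        (c₀ : Fin P.K → ℕ) : ∃ v, P.IsLongRunAverage θ x c₀ v ∧ P.fluidValue ≤ v := by
      obtain ⟨n, hn, hval⟩ := hx.exists_eq_fluidValue
      have hN := Platform.sum_eq_zero hn h0.symm
      obtain ⟨v, hv, hle⟩ := Platform.exists_longRunAverage hn (b := 0) (C := 0) (e := 0) le_rfl
        (fun y hy ↦ by
          rw [hN]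
          have := P.R_monotone (mem_Ici.2 le_rfl) (mem_Ici.2 hy) hy
          linarith) hθ c₀
      exact ⟨v, hv, by rw [← hval]; simpa using hle⟩
    refine ⟨fun _ ↦ ⟨1, one_pos, fun x hx θ hθ c₀ ↦ ?_⟩,
      fun _ _ _ ↦ ⟨1, one_pos, fun x hx θ hθ _ c₀ ↦ ?_⟩⟩
    all_goals
      obtain ⟨v, hv, hle⟩ := hexact x hx θ hθ c₀
      refine ⟨v, hv, le_trans (sub_le_self _ (by positivity)) hle⟩
  set A := ∑ i, (P.lam i : ℝ) with hA
  have hB := P.LamBar_nonneg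
  constructor
  · rintro ⟨L, hL⟩
    have hRB := P.R_nonneg _ hB
    have hc : 0 ≤ P.R P.LamBar / A ^ 2 := by positivity
    refine ⟨(L / 2 + P.R P.LamBar / A ^ 2) * P.K * P.LamBar + L / 2 + 1, by positivity,
      fun x hx θ hθ c₀ ↦ ?_⟩
    obtain ⟨n, hn, hval⟩ := hx.exists_eq_fluidValue
    have hθ1 : (1 : ℝ) ≤ θ := by exact_mod_cast hθ
    set s := Real.sqrt θ with hs
    have hs1 : 1 ≤ s := Real.one_le_sqrt.2 hθ1
    have hss : (θ : ℝ) = s ^ 2 := (Real.sq_sqrt (by positivity)).symm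
    have hs0 : 0 < s := by linarith
    obtain ⟨v, hv, hle⟩ := Platform.exists_longRunAverage hn (b := 0)
      (C := L / 2 * s + P.R P.LamBar / A ^ 2) (e := L / 2 / s) (by positivity)
      (fun y hy ↦ Platform.lipschitz_lower_bound hL hpos (Platform.sum_lam_le hn)
        (Platform.sum_le_LamBar hn) hs0 hy) hθ c₀
    refine ⟨v, hv, le_trans ?_ hle⟩
    have hNB := Platform.sum_le_LamBar hn
    have hN0 : 0 ≤ ∑ i, n i := hpos.le.trans (Platform.sum_lam_le hn)
    have h1 : (L / 2 * s + P.R P.LamBar / A ^ 2) * P.K * (∑ i, n i) / θ ≤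
        (L / 2 + P.R P.LamBar / A ^ 2) * P.K * P.LamBar / s := by
      calc (L / 2 * s + P.R P.LamBar / A ^ 2) * P.K * (∑ i, n i) / θ
          ≤ (L / 2 * s + P.R P.LamBar / A ^ 2 * s) * P.K * P.LamBar / θ := by
            gcongr
            exact le_mul_of_one_le_right hc hs1
        _ = _ := by rw [hss]; field_simp
    have h2 : ((L / 2 + P.R P.LamBar / A ^ 2) * P.K * P.LamBar + L / 2 + 1) / s =
      (L / 2 + P.R P.LamBar / A ^ 2) * P.K * P.LamBar / s + L / 2 / s + 1 / s := by
      rw [add_div, add_div]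
    have h3 : 0 ≤ 1 / s := by positivity
    rw [h2, hval]
    linarith
  · intro hR α _
    obtain ⟨x₀, n₀, hn₀, -⟩ := P.exists_isFluidOptimal
    obtain ⟨C, hC, hbound⟩ := Platform.exists_taylor_lower_bound hR hpos
      ((Platform.sum_lam_le hn₀).trans (Platform.sum_le_LamBar hn₀))
    refine ⟨C * P.K * P.LamBar + 1, by positivity, fun x hx θ hθ _ c₀ ↦ ?_⟩
    obtain ⟨n, hn, hval⟩ := hx.exists_eq_fluidValue
    have hNB := Platform.sum_le_LamBar hn
    obtain ⟨v, hv, hle⟩ := Platform.exists_longRunAverage hn hC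
      (hbound _ ⟨Platform.sum_lam_le hn, hNB⟩) hθ c₀
    refine ⟨v, hv, le_trans ?_ hle⟩
    rw [hval, sub_zero]
    gcongr
    have := mul_le_mul_of_nonneg_left hNB (by positivity : 0 ≤ C * P.K)
    linarith
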